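/- Let $A\in\mathbf{R}^{m\times n}$, $B\in\mathbf{R}^{\nu\times n}$, $\sigma>0$, and let $S\in\mathbf{R}^{n\times n}$ be symmetric positive semidefinite. One observes $\omega=Ax+\sigma\xi$ with $\xi\sim\mathcal N(0,I_m)$ and unknown $x\in\mathbf{R}^n$, and wants to recover $Bx$. For a Borel estimate $\widehat w:\mathbf{R}^m\to\mathbf{R}^\nu$ define its $S$-risk over $\mathbf{R}^n$ by \[ \mathrm{RiskS}[\widehat w\,|\,\mathbf{R}^n]=\inf\Big\{\sqrt{\tau}:\ \tau\ge 0,\ \mathbf{E}_{\xi\sim\mathcal N(0,I_m)}\big\{\|\widehat w(Ax+\sigma\xi)-Bx\|_2^2\big\}\le\tau(1+x^TSx)\ \ \forall x\in\mathbf{R}^n\Big\} \] (with value $+\infty$ if there is no such $\tau$). Consider the semidefinite program in the variables $\tau\in\mathbf{R}$, $H\in\mathbf{R}^{m\times\nu}$, \[ \mathrm{Opt}=\min_{\tau,H}\left\{\tau:\ \begin{bmatrix}\tau S& B^T-A^TH\\ B-H^TA& I_\nu\end{bmatrix}\succeq 0,\ \ \sigma^2\,\mathrm{Tr}(H^TH)\le\tau\right\}.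 \] Assume that this program is feasible. Then it is solvable (the minimum is attained), and for every optimal solution $(\mathrm{Opt},H_*)$ the linear estimate $\widehat w_{H_*}(\omega)=H_*^T\omega$ is minimax optimal: \[ \mathrm{RiskS}[\widehat w_{H_*}|\mathbf{R}^n]=\sqrt{\mathrm{Opt}}=\inf_{\widehat w(\cdot)}\mathrm{RiskS}[\widehat w(\cdot)|\mathbf{R}^n], \] where the infimum is taken over all Borel functions $\widehat w:\mathbf{R}^m\to\mathbf{R}^\nu$. -/

import Mathlib

open MeasureTheory ProbabilityTheory Matrix
open scoped ENNReal

namespace SRisk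

/-- The linear map `x ↦ M x` between Euclidean spaces given by a `p × q` real matrix. -/
noncomputable def act {p q : ℕ} (M : Matrix (Fin p) (Fin q) ℝ) (x : EuclideanSpace ℝ (Fin q)) :
    EuclideanSpace ℝ (Fin p) :=
  WithLp.toLp 2 (M *ᵥ WithLp.ofLp x)

/-- The quadratic form `xᵀ S x`. -/
noncomputable def quadForm {n : ℕ} (S : Matrix (Fin n) (Fin n) ℝ) (x : EuclideanSpace ℝ (Fin n)) :
    ℝ :=
  WithLp.ofLp x ⬝ᵥ (S *ᵥ WithLp.ofLp x)

/-- The expected squared error `𝔼 ‖ŵ(A x + σ ξ) - B x‖²` with `ξ ∼ 𝒩(0, I_m)`, as an element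
of `[0, ∞]`. -/
noncomputable def expSqError {n m ν : ℕ} (A : Matrix (Fin m) (Fin n) ℝ)
    (B : Matrix (Fin ν) (Fin n) ℝ) (σ : ℝ)
    (w : EuclideanSpace ℝ (Fin m) → EuclideanSpace ℝ (Fin ν))
    (x : EuclideanSpace ℝ (Fin n)) : ℝ≥0∞ :=
  ∫⁻ ξ, ENNReal.ofReal (‖w (act A x + σ • ξ) - act B x‖ ^ 2)
    ∂(stdGaussian (EuclideanSpace ℝ (Fin m)))

/-- The `S`-risk of the estimate `w` on the signal set `X`: the infimum of `√τ` over those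
`τ ≥ 0` with `𝔼 ‖ŵ(A x + σ ξ) - B x‖² ≤ τ (1 + xᵀ S x)` for all `x ∈ X`
(equal to `∞` when there is no such `τ`). -/
noncomputable def riskS {n m ν : ℕ} (A : Matrix (Fin m) (Fin n) ℝ)
    (B : Matrix (Fin ν) (Fin n) ℝ) (S : Matrix (Fin n) (Fin n) ℝ) (σ : ℝ)
    (X : Set (EuclideanSpace ℝ (Fin n)))
    (w : EuclideanSpace ℝ (Fin m) → EuclideanSpace ℝ (Fin ν)) : ℝ≥0∞ :=
  sInf {r : ℝ≥0∞ | ∃ τ : ℝ, 0 ≤ τ ∧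
    (∀ x ∈ X, expSqError A B σ w x ≤ ENNReal.ofReal (τ * (1 + quadForm S x))) ∧
    r = ENNReal.ofReal (Real.sqrt τ)}

/-- The minimax `S`-risk: the infimum of the `S`-risk over all Borel estimates. -/
noncomputable def minimaxRiskS {n m ν : ℕ} (A : Matrix (Fin m) (Fin n) ℝ)
    (B : Matrix (Fin ν) (Fin n) ℝ) (S : Matrix (Fin n) (Fin n) ℝ) (σ : ℝ)
    (X : Set (EuclideanSpace ℝ (Fin n))) : ℝ≥0∞ :=
  ⨅ (w : EuclideanSpace ℝ (Fin m) → EuclideanSpace ℝ (Fin ν)) (_ : Measurable w),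
    riskS A B S σ X w

/-- The linear estimate `ω ↦ Hᵀ ω`. -/
noncomputable def linearEstimate {m ν : ℕ} (H : Matrix (Fin m) (Fin ν) ℝ) :
    EuclideanSpace ℝ (Fin m) → EuclideanSpace ℝ (Fin ν) :=
  fun ω => act Hᵀ ω

/-- Feasibility of `(τ, H)` for the semidefinite program minimizing `τ`. -/
def IsFeasible {n m ν : ℕ} (A : Matrix (Fin m) (Fin n) ℝ)
    (B : Matrix (Fin ν) (Fin n) ℝ) (S : Matrix (Fin n) (Fin n) ℝ) (σ : ℝ)
    (τ : ℝ) (H : Matrix (Fin m) (Fin ν) ℝ) : Prop :=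
  (fromBlocks (τ • S) (Bᵀ - Aᵀ * H) (B - Hᵀ * A)
    (1 : Matrix (Fin ν) (Fin ν) ℝ)).PosSemidef ∧
  σ ^ 2 * (Hᵀ * H).trace ≤ τ

/-- `(τ, H)` is an optimal solution to the program (so that `τ` is its optimal value). -/
def IsOptimalSolution {n m ν : ℕ} (A : Matrix (Fin m) (Fin n) ℝ)
    (B : Matrix (Fin ν) (Fin n) ℝ) (S : Matrix (Fin n) (Fin n) ℝ) (σ : ℝ)
    (τ : ℝ) (H : Matrix (Fin m) (Fin ν) ℝ) : Prop :=
  IsFeasible A B S σ τ H ∧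
    ∀ (τ' : ℝ) (H' : Matrix (Fin m) (Fin ν) ℝ), IsFeasible A B S σ τ' H' → τ ≤ τ'

end SRisk

/-! A linear estimate has error exactly `‖(B - HᵀA)x‖² + σ² tr(HᵀH)`. A Schur complement turns the
matrix inequality into `‖(B - HᵀA)x‖² ≤ τ xᵀSx`, so feasibility gives risk at most `√τ`.

For the lower bound, suppose some Borel estimate achieves `τ < Opt`, and take `τ < τ' < Opt`. No `H`
is feasible at `τ'`, so each `H` violates the risk bound at some `x`. Compactness in `H` leaves
finitely many points `xᵢ`, and convex separation (`exists_weights_of_forall_exists_nonneg`) gives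
weights `cᵢ` for which the averaged bound fails, at least weakly, for every `H`. Under the Gaussian
prior with covariance `∑ cᵢ xᵢ xᵢᵀ` a linear estimate is Bayes optimal
(`exists_linear_bayes_optimal`), so some `H` meets the averaged bound with `τ`, a contradiction. The
prior may have unbounded support because the risk bound holds on the whole space. -/

namespace SRisk

/-! ### Convex separation -/

/-- A form of the minimax theorem for finitely many convex functions. -/
theorem exists_weights_of_forall_exists_nonneg {V ι : Type*} [AddCommGroup V] [Module ℝ V]
    [Fintype ι] {g : ι → V → ℝ} (hg : ∀ i, ConvexOn ℝ Set.univ (g i))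
    (h : ∀ v, ∃ i, 0 ≤ g i v) :
    ∃ c : ι → ℝ, (∀ i, 0 ≤ c i) ∧ ∑ i, c i = 1 ∧ ∀ v, 0 ≤ ∑ i, c i * g i v := by
  classical
  -- Separate the open negative orthant from the upward closure of the range of `g`; the normalized
  -- separating functional supplies the weights.
  let s : Set (ι → ℝ) := Set.univ.pi fun _ => Set.Iio 0
  let t : Set (ι → ℝ) := {y | ∃ v, ∀ i, g i v ≤ y i}
  have hs : Convex ℝ s := convex_pi fun _ _ => convex_Iio 0
  have hso : IsOpen s := isOpen_set_pi Set.finite_univ fun _ _ => isOpen_Iio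
  have ht : Convex ℝ t := by
    rintro y ⟨v, hv⟩ z ⟨w, hw⟩ a b ha hb hab
    refine ⟨a • v + b • w, fun i => ((hg i).2 (Set.mem_univ v) (Set.mem_univ w) ha hb hab).trans ?_⟩
    simp only [Pi.add_apply, Pi.smul_apply, smul_eq_mul]
    gcongr
    · exact hv i
    · exact hw i
  have hst : Disjoint s t := by
    rw [Set.disjoint_left]
    rintro y hy ⟨v, hv⟩
    obtain ⟨i, hi⟩ := h v
    have : y i < 0 := hy i trivial
    linarith [hv i]
  obtain ⟨f, u, hfs, hft⟩ := geometric_hahn_banach_open hs hso ht hst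
  have hf : ∀ y : ι → ℝ, f y = ∑ i, f (Pi.single i 1) * y i := by
    intro y
    conv_lhs => rw [pi_eq_sum_univ' y]
    simp [map_sum, mul_comm]
  have hmem : ∀ v, (fun i => g i v) ∈ t := fun v => ⟨v, fun i => le_rfl⟩
  have hu : 0 ≤ u := by
    by_contra! hu
    have hneg : ∀ ε : ℝ, 0 < ε → (fun _ : ι => -ε) ∈ s := fun ε hε i _ => by simpa using hε
    have key : ∀ ε : ℝ, 0 < ε → -ε * (∑ i, f (Pi.single i 1)) < u := fun ε hε => by
      have := hfs _ (hneg ε hε)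
      rw [hf, ← Finset.sum_mul] at this
      linarith
    have h1 := key 1 one_pos
    have hS : 0 < ∑ i, f (Pi.single i 1) := by linarith
    -- This `ε` makes the functional take the value `u` itself on the orthant, against the strict
    -- bound.
    have h2 := key (-u / (∑ i, f (Pi.single i 1))) (by apply div_pos <;> linarith)
    rw [neg_mul, div_mul_cancel₀ _ hS.ne'] at h2
    linarith
  have hc : ∀ i, 0 ≤ f (Pi.single i 1) := by
    intro i
    by_contra! hi
    have key : ∀ N : ℝ, 0 ≤ N → u ≤ f (fun i => g i 0) + N * f (Pi.single i 1) := by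
      intro N hN
      have : (fun i => g i 0) + N • Pi.single i (1 : ℝ) ∈ t := by
        refine ⟨0, fun j => ?_⟩
        have : 0 ≤ (Pi.single i (1 : ℝ) : ι → ℝ) j := by
          rw [Pi.single_apply]; split_ifs <;> norm_num
        simp only [Pi.add_apply, Pi.smul_apply, smul_eq_mul]
        nlinarith
      simpa using hft _ this
    have h0 := key 0 le_rfl
    -- A negative coefficient lets the functional drop to `u - 1` along an upward ray of `t`.
    have h1 := key ((f (fun i => g i 0) - u + 1) / (-f (Pi.single i 1)))
      (div_nonneg (by linarith) (by linarith))
    rw [div_mul_eq_mul_div, div_neg, mul_div_cancel_right₀ _ hi.ne] at h1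
    linarith
  have hpos : 0 < ∑ i, f (Pi.single i 1) := by
    have h1 := hfs (fun _ => -1) (fun i _ => by simp)
    have h2 := hft _ (hmem 0)
    refine (Finset.sum_nonneg fun i _ => hc i).lt_of_ne fun h0 => ?_
    have hz : ∀ i, f (Pi.single i 1) = 0 := fun i =>
      (Finset.sum_eq_zero_iff_of_nonneg fun i _ => hc i).1 h0.symm i (Finset.mem_univ i)
    rw [hf] at h1 h2
    simp only [hz, zero_mul, Finset.sum_const_zero] at h1 h2
    linarith
  refine ⟨fun i => f (Pi.single i 1) / ∑ j, f (Pi.single j 1), fun i => div_nonneg (hc i) hpos.le,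
    by rw [← Finset.sum_div, div_self hpos.ne'], fun v => ?_⟩
  have := hu.trans (hft _ (hmem v))
  rw [hf] at this
  simp_rw [div_mul_eq_mul_div]
  rw [← Finset.sum_div]
  exact div_nonneg this hpos.le

/-! ### Gaussian measures and Bayes optimality -/

section Gaussian

variable {E P W : Type*}
  [NormedAddCommGroup E] [InnerProductSpace ℝ E] [FiniteDimensional ℝ E]
  [NormedAddCommGroup P] [InnerProductSpace ℝ P] [FiniteDimensional ℝ P]
  [NormedAddCommGroup W] [InnerProductSpace ℝ W] [FiniteDimensional ℝ W]
  [MeasurableSpace E] [BorelSpace E] [MeasurableSpace P] [BorelSpace P]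
  [MeasurableSpace W] [BorelSpace W]

theorem stdGaussian_prod :
    ((stdGaussian E).prod (stdGaussian P)).map (WithLp.toLp 2) = stdGaussian (WithLp 2 (E × P)) := by
  apply Measure.ext_of_charFun
  ext t
  rw [charFun_prod, charFun_stdGaussian, charFun_stdGaussian, charFun_stdGaussian, ← Complex.exp_add,
    ← Complex.ofReal_pow, ← Complex.ofReal_pow, ← Complex.ofReal_pow, WithLp.prod_norm_sq_eq_of_L2]
  congr 1
  push_cast
  simp only [WithLp.fst, WithLp.snd]
  ring

omit [FiniteDimensional ℝ P] [MeasurableSpace P] [BorelSpace P] [FiniteDimensional ℝ W]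
  [MeasurableSpace W] [BorelSpace W] [MeasurableSpace E] [BorelSpace E] in
-- `L` is injective on `(ker L)ᗮ` and does not see the component in `ker L`, so a left inverse there
-- recovers the projection of `z` from `L z`.
theorem exists_comp_eq_comp_starProjection (L : E →ₗ[ℝ] P) (F : E →ₗ[ℝ] W) :
    ∃ K : P →ₗ[ℝ] W, ∀ z, K (L z) = F ((LinearMap.ker L)ᗮ.starProjection z) := by
  obtain ⟨g, hg⟩ := (L.domRestrict (LinearMap.ker L)ᗮ).exists_leftInverse_of_injective (by
    rw [LinearMap.ker_eq_bot']
    rintro ⟨z, hz⟩ h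
    have hz' : z ∈ LinearMap.ker L := h
    have := (LinearMap.ker L).inner_right_of_mem_orthogonal hz' hz
    simpa using this)
  refine ⟨F ∘ₗ (LinearMap.ker L)ᗮ.subtype ∘ₗ g, fun z => ?_⟩
  have h1 : L z = L.domRestrict (LinearMap.ker L)ᗮ ⟨(LinearMap.ker L)ᗮ.starProjection z,
      Submodule.starProjection_apply_mem _ z⟩ := by
    have : z - (LinearMap.ker L)ᗮ.starProjection z ∈ (LinearMap.ker L)ᗮᗮ :=
      Submodule.sub_starProjection_mem_orthogonal z
    rw [Submodule.orthogonal_orthogonal, LinearMap.mem_ker, map_sub, sub_eq_zero] at this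
    simpa using this
  have h2 := LinearMap.congr_fun hg ⟨(LinearMap.ker L)ᗮ.starProjection z,
      Submodule.starProjection_apply_mem _ z⟩
  rw [LinearMap.comp_apply, ← h1] at h2
  simp [h2]

/-- Under a standard Gaussian prior, some linear function of a linear observation is
a best mean-square predictor of a linear image. -/
theorem exists_linear_bayes_optimal (L : E →ₗ[ℝ] P) (F : E →ₗ[ℝ] W) :
    ∃ K : P →ₗ[ℝ] W, ∀ w : P → W, Measurable w →
      ∫⁻ z, ENNReal.ofReal (‖K (L z) - F z‖ ^ 2) ∂(stdGaussian E) ≤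
        ∫⁻ z, ENNReal.ofReal (‖w (L z) - F z‖ ^ 2) ∂(stdGaussian E) := by
  obtain ⟨K, hK⟩ := exists_comp_eq_comp_starProjection L F
  refine ⟨K, fun w hw => ?_⟩
  set V := LinearMap.ker L
  -- This reflection preserves both the Gaussian and the observation `L z`, but flips the sign of
  -- the error `K (L z) - F z`. Averaging over it cancels the cross term for any competitor `w`.
  let R := Vᗮ.reflection
  have hR : ∀ z, R z = 2 • Vᗮ.starProjection z - z := fun z => Vᗮ.reflection_apply z
  have hPz : ∀ z, L (Vᗮ.starProjection z) = L z := fun z => by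
    have : z - Vᗮ.starProjection z ∈ Vᗮᗮ := Submodule.sub_starProjection_mem_orthogonal z
    rw [Submodule.orthogonal_orthogonal, LinearMap.mem_ker, map_sub, sub_eq_zero] at this
    exact this.symm
  have hLR : ∀ z, L (R z) = L z := fun z => by
    rw [hR, map_sub, map_nsmul, hPz, two_smul, add_sub_cancel_right]
  have hr : ∀ z, K (L z) - F (R z) = -(K (L z) - F z) := fun z => by
    rw [hR, map_sub, map_nsmul, hK, two_smul]; abel
  have hLm : Measurable L := L.continuous_of_finiteDimensional.measurable
  have hFm : Measurable F := F.continuous_of_finiteDimensional.measurable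
  have hKm : Measurable K := K.continuous_of_finiteDimensional.measurable
  have hmeas : Measurable fun z => ENNReal.ofReal (‖w (L z) - F z‖ ^ 2) := by fun_prop
  have hmeas' : Measurable fun z => ENNReal.ofReal (‖K (L z) - F z‖ ^ 2) := by fun_prop
  have hinv : ∫⁻ z, ENNReal.ofReal (‖w (L z) - F (R z)‖ ^ 2) ∂(stdGaussian E) =
      ∫⁻ z, ENNReal.ofReal (‖w (L z) - F z‖ ^ 2) ∂(stdGaussian E) := by
    conv_rhs => rw [← stdGaussian_map R, lintegral_map hmeas R.continuous.measurable]
    simp_rw [hLR]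
  have hsum : 2 * ∫⁻ z, ENNReal.ofReal (‖K (L z) - F z‖ ^ 2) ∂(stdGaussian E) ≤
      2 * ∫⁻ z, ENNReal.ofReal (‖w (L z) - F z‖ ^ 2) ∂(stdGaussian E) := by
    nth_rw 2 [two_mul]
    nth_rw 2 [← hinv]
    rw [← lintegral_add_left hmeas, ← lintegral_const_mul _ hmeas']
    refine lintegral_mono fun z => ?_
    simp only
    rw [← ENNReal.ofReal_add (by positivity) (by positivity),
      show (2 : ℝ≥0∞) = ENNReal.ofReal 2 by simp, ← ENNReal.ofReal_mul (by norm_num)]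
    refine ENNReal.ofReal_le_ofReal ?_
    have h1 : w (L z) - F z = (w (L z) - K (L z)) + (K (L z) - F z) := by abel
    have h2 : w (L z) - F (R z) = (w (L z) - K (L z)) - (K (L z) - F z) := by
      rw [sub_eq_add_neg _ (K (L z) - F z), ← hr]; abel
    have := parallelogram_law_with_norm ℝ (w (L z) - K (L z)) (K (L z) - F z)
    rw [h1, h2]
    nlinarith [sq_nonneg ‖w (L z) - K (L z)‖]
  exact (ENNReal.mul_le_mul_iff_right (by norm_num) (by norm_num)).1 hsum

/-- Signal and noise together form one standard Gaussian on the `L²` product, of which observation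
and target are linear functions. -/
theorem exists_linear_bayes_optimal_of_noisy_observation (a : E →ₗ[ℝ] P) (σ : ℝ) (b : E →ₗ[ℝ] W) :
    ∃ K : P →ₗ[ℝ] W, ∀ w : P → W, Measurable w →
      ∫⁻ η, ∫⁻ ξ, ENNReal.ofReal (‖K (a η + σ • ξ) - b η‖ ^ 2) ∂(stdGaussian P) ∂(stdGaussian E) ≤
        ∫⁻ η, ∫⁻ ξ, ENNReal.ofReal (‖w (a η + σ • ξ) - b η‖ ^ 2)
          ∂(stdGaussian P) ∂(stdGaussian E) := by
  let L : WithLp 2 (E × P) →ₗ[ℝ] P := a ∘ₗ WithLp.fstₗ 2 ℝ E P + σ • WithLp.sndₗ 2 ℝ E P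
  let F : WithLp 2 (E × P) →ₗ[ℝ] W := b ∘ₗ WithLp.fstₗ 2 ℝ E P
  have hLm : Measurable L := L.continuous_of_finiteDimensional.measurable
  have hFm : Measurable F := F.continuous_of_finiteDimensional.measurable
  have hrisk : ∀ w : P → W, Measurable w →
      ∫⁻ z, ENNReal.ofReal (‖w (L z) - F z‖ ^ 2) ∂(stdGaussian (WithLp 2 (E × P))) =
        ∫⁻ η, ∫⁻ ξ, ENNReal.ofReal (‖w (a η + σ • ξ) - b η‖ ^ 2)
          ∂(stdGaussian P) ∂(stdGaussian E) := fun w hw => by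
    have hm : Measurable fun z => ENNReal.ofReal (‖w (L z) - F z‖ ^ 2) := by fun_prop
    rw [← stdGaussian_prod, lintegral_map hm (by fun_prop), lintegral_prod _ (by fun_prop)]
    rfl
  obtain ⟨K, hK⟩ := exists_linear_bayes_optimal L F
  refine ⟨K, fun w hw => ?_⟩
  rw [← hrisk w hw, ← hrisk K K.continuous_of_finiteDimensional.measurable]
  exact hK w hw

theorem integrable_inner_sq (a : E) :
    Integrable (fun z => inner ℝ a z ^ 2) (stdGaussian E) :=
  ((IsGaussian.memLp_two_id (μ := stdGaussian E)).const_inner a).integrable_sq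

theorem integral_inner_sq (a : E) :
    ∫ z, inner ℝ a z ^ 2 ∂(stdGaussian E) = ‖a‖ ^ 2 := by
  have h := variance_dual_stdGaussian (innerSL ℝ a)
  rw [variance_of_integral_eq_zero (innerSL ℝ a).continuous.aemeasurable
    (integral_strongDual_stdGaussian _), innerSL_apply_norm] at h
  simpa using h

omit [MeasurableSpace W] [BorelSpace W] in
-- The cross term has mean zero, and the quadratic term is the squared Hilbert–Schmidt norm of `T`,
-- computed through the adjoint.
theorem lintegral_norm_add_linear_sq {ι : Type*} [Fintype ι] (b : OrthonormalBasis ι ℝ E) (c : W)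
    (T : E →ₗ[ℝ] W) :
    ∫⁻ z, ENNReal.ofReal (‖c + T z‖ ^ 2) ∂(stdGaussian E) =
      ENNReal.ofReal (‖c‖ ^ 2 + ∑ i, ‖T (b i)‖ ^ 2) := by
  let e := stdOrthonormalBasis ℝ W
  let T' := LinearMap.adjoint T
  have hT : ∀ z, ‖T z‖ ^ 2 = ∑ j, inner ℝ (T' (e j)) z ^ 2 := fun z => by
    rw [← e.sum_sq_inner_right]
    simp [T', LinearMap.adjoint_inner_left]
  have hlin : ∀ z, 2 * inner ℝ c (T z) = (2 : ℝ) * innerSL ℝ (T' c) z := fun z => by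
    simp [T', LinearMap.adjoint_inner_left]
  have hexp : ∀ z, ‖c + T z‖ ^ 2 =
      ‖c‖ ^ 2 + 2 * innerSL ℝ (T' c) z + ∑ j, inner ℝ (T' (e j)) z ^ 2 := fun z => by
    rw [norm_add_sq_real, hlin, hT]
  have hi1 : Integrable (fun z => 2 * innerSL ℝ (T' c) z) (stdGaussian E) :=
    ((innerSL ℝ (T' c)).integrable_comp IsGaussian.integrable_id).const_mul 2
  have hi2 : Integrable (fun z => ∑ j, inner ℝ (T' (e j)) z ^ 2) (stdGaussian E) :=
    integrable_finsetSum _ fun j _ => integrable_inner_sq _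
  have hi3 : Integrable (fun z => ‖c‖ ^ 2 + 2 * innerSL ℝ (T' c) z) (stdGaussian E) :=
    (integrable_const _).add hi1
  have hi4 : Integrable (fun z => ‖c‖ ^ 2 + 2 * innerSL ℝ (T' c) z +
      ∑ j, inner ℝ (T' (e j)) z ^ 2) (stdGaussian E) := hi3.add hi2
  simp_rw [hexp]
  rw [← ofReal_integral_eq_lintegral_ofReal hi4
    (Filter.Eventually.of_forall fun z => by simp only [Pi.zero_apply, ← hexp]; positivity)]
  congr 1
  rw [integral_add hi3 hi2, integral_add (integrable_const _) hi1, integral_const_mul,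
    integral_strongDual_stdGaussian, integral_finsetSum _ fun j _ => integrable_inner_sq _]
  simp_rw [integral_inner_sq, ← b.sum_sq_inner_right]
  rw [Finset.sum_comm]
  simp_rw [← e.sum_sq_inner_right (T _)]
  simp [T', LinearMap.adjoint_inner_right, real_inner_comm]

end Gaussian

/-! ### Matrices and quadratic forms -/

section Matrices

variable {p q r : ℕ}

theorem act_eq_toEuclideanLin (M : Matrix (Fin p) (Fin q) ℝ) (x : EuclideanSpace ℝ (Fin q)) :
    act M x = toEuclideanLin M x := rfl

theorem act_add (M : Matrix (Fin p) (Fin q) ℝ) (x y : EuclideanSpace ℝ (Fin q)) :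
    act M (x + y) = act M x + act M y := map_add (toEuclideanLin M) x y

theorem act_smul (M : Matrix (Fin p) (Fin q) ℝ) (c : ℝ) (x : EuclideanSpace ℝ (Fin q)) :
    act M (c • x) = c • act M x := map_smul (toEuclideanLin M) c x

theorem act_sub_left (M N : Matrix (Fin p) (Fin q) ℝ) (x : EuclideanSpace ℝ (Fin q)) :
    act (M - N) x = act M x - act N x := by simp [act, sub_mulVec]

theorem act_mul (M : Matrix (Fin p) (Fin q) ℝ) (N : Matrix (Fin q) (Fin r) ℝ)
    (x : EuclideanSpace ℝ (Fin r)) : act (M * N) x = act M (act N x) := by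
  simp [act]

theorem continuous_act (M : Matrix (Fin p) (Fin q) ℝ) : Continuous (act M) :=
  (toEuclideanLin M).continuous_of_finiteDimensional

theorem norm_act_sq (M : Matrix (Fin p) (Fin q) ℝ) (x : EuclideanSpace ℝ (Fin q)) :
    ‖act M x‖ ^ 2 = WithLp.ofLp x ⬝ᵥ ((Mᵀ * M) *ᵥ WithLp.ofLp x) := by
  rw [EuclideanSpace.real_norm_sq_eq, ← mulVec_mulVec, dotProduct_mulVec, vecMul_transpose]
  simp [act, dotProduct, sq]

theorem trace_transpose_mul_self (M : Matrix (Fin p) (Fin q) ℝ) :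
    (Mᵀ * M).trace = ∑ j, ∑ i, M i j ^ 2 := by
  simp [trace, mul_apply, sq]

theorem sum_norm_act_transpose_sq (M : Matrix (Fin p) (Fin q) ℝ) :
    ∑ i, ‖act Mᵀ (EuclideanSpace.basisFun (Fin p) ℝ i)‖ ^ 2 = (Mᵀ * M).trace := by
  rw [trace_transpose_mul_self, Finset.sum_comm]
  simp [EuclideanSpace.real_norm_sq_eq, act, EuclideanSpace.basisFun_apply]

theorem quadForm_eq_inner (S : Matrix (Fin p) (Fin p) ℝ) (x : EuclideanSpace ℝ (Fin p)) :
    quadForm S x = inner ℝ x (act S x) := by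
  simp [quadForm, act, EuclideanSpace.inner_eq_star_dotProduct, dotProduct_comm]

theorem quadForm_smul (S : Matrix (Fin p) (Fin p) ℝ) (c : ℝ) (x : EuclideanSpace ℝ (Fin p)) :
    quadForm S (c • x) = c ^ 2 * quadForm S x := by
  rw [quadForm_eq_inner, quadForm_eq_inner, act_smul, real_inner_smul_left, real_inner_smul_right]
  ring

theorem quadForm_nonneg {S : Matrix (Fin p) (Fin p) ℝ} (hS : S.PosSemidef)
    (x : EuclideanSpace ℝ (Fin p)) : 0 ≤ quadForm S x := by
  exact hS.dotProduct_mulVec_nonneg (WithLp.ofLp x)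

open scoped MatrixOrder in
theorem exists_quadForm_eq_norm_sq {S : Matrix (Fin p) (Fin p) ℝ} (hS : S.PosSemidef) :
    ∃ R : Matrix (Fin p) (Fin p) ℝ, ∀ x, quadForm S x = ‖act R x‖ ^ 2 := by
  obtain ⟨R, rfl⟩ := CStarAlgebra.nonneg_iff_eq_star_mul_self.mp hS.nonneg
  refine ⟨R, fun x => ?_⟩
  rw [norm_act_sq]
  rfl

end Matrices

/-! ### The semidefinite program and risk bounds -/

variable {n m ν : ℕ} {A : Matrix (Fin m) (Fin n) ℝ} {B : Matrix (Fin ν) (Fin n) ℝ}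
  {S : Matrix (Fin n) (Fin n) ℝ} {σ : ℝ}

/-- Schur complement with respect to the identity block. -/
theorem isFeasible_iff (hS : S.PosSemidef) {τ : ℝ} {H : Matrix (Fin m) (Fin ν) ℝ} :
    IsFeasible A B S σ τ H ↔
      (∀ x, ‖act (B - Hᵀ * A) x‖ ^ 2 ≤ τ * quadForm S x) ∧ σ ^ 2 * (Hᵀ * H).trace ≤ τ := by
  have hB : B - Hᵀ * A = (Bᵀ - Aᵀ * H)ᴴ := by
    simp [conjTranspose_eq_transpose_of_trivial, transpose_mul]
  unfold IsFeasible
  refine and_congr_left' ?_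
  let : Invertible (1 : Matrix (Fin ν) (Fin ν) ℝ) := invertibleOne
  have hB' : Bᵀ - Aᵀ * H = (B - Hᵀ * A)ᵀ := by simp [transpose_mul]
  have key : ∀ x : EuclideanSpace ℝ (Fin n), star (WithLp.ofLp x) ⬝ᵥ
      ((τ • S - (B - Hᵀ * A)ᵀ * (B - Hᵀ * A)) *ᵥ WithLp.ofLp x) =
      τ * quadForm S x - ‖act (B - Hᵀ * A) x‖ ^ 2 := fun x => by
    rw [norm_act_sq, sub_mulVec, dotProduct_sub, smul_mulVec, dotProduct_smul]
    simp [quadForm]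
  conv_lhs => rw [hB]
  rw [PosDef.fromBlocks₂₂ _ _ PosDef.one, ← hB, inv_one, Matrix.mul_one, hB',
    posSemidef_iff_dotProduct_mulVec]
  constructor
  · rintro ⟨-, h⟩ x
    have := h (WithLp.ofLp x)
    rw [key] at this
    linarith
  · refine fun h => ⟨?_, fun x => ?_⟩
    · refine (hS.isHermitian.smul (IsSelfAdjoint.all τ)).sub ?_
      simpa [conjTranspose_eq_transpose_of_trivial] using
        isHermitian_conjTranspose_mul_self (B - Hᵀ * A)
    · have := key (WithLp.toLp 2 x)
      simp only at this
      rw [this]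
      linarith [h (WithLp.toLp 2 x)]

theorem expSqError_linearEstimate (H : Matrix (Fin m) (Fin ν) ℝ)
    (x : EuclideanSpace ℝ (Fin n)) :
    expSqError A B σ (linearEstimate H) x =
      ENNReal.ofReal (‖act (B - Hᵀ * A) x‖ ^ 2 + σ ^ 2 * (Hᵀ * H).trace) := by
  have h := lintegral_norm_add_linear_sq (EuclideanSpace.basisFun (Fin m) ℝ)
    (-act (B - Hᵀ * A) x) (σ • toEuclideanLin Hᵀ)
  have hs : ∑ i, ‖(σ • toEuclideanLin Hᵀ) (EuclideanSpace.basisFun (Fin m) ℝ i)‖ ^ 2 =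
      σ ^ 2 * (Hᵀ * H).trace := by
    rw [← sum_norm_act_transpose_sq, Finset.mul_sum]
    simp only [LinearMap.smul_apply, norm_smul, mul_pow, act_eq_toEuclideanLin, Real.norm_eq_abs,
      sq_abs]
  rw [norm_neg, hs] at h
  rw [← h, expSqError]
  congr! 5 with ξ
  rw [linearEstimate, act_add, act_smul, act_sub_left, act_mul, LinearMap.smul_apply,
    ← act_eq_toEuclideanLin]
  abel

theorem riskS_linearEstimate_le (hS : S.PosSemidef) {τ : ℝ} (hτ : 0 ≤ τ)
    {H : Matrix (Fin m) (Fin ν) ℝ} (h : IsFeasible A B S σ τ H) :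
    riskS A B S σ Set.univ (linearEstimate H) ≤ ENNReal.ofReal √τ := by
  refine sInf_le ⟨τ, hτ, fun x _ => ?_, rfl⟩
  rw [isFeasible_iff hS] at h
  rw [expSqError_linearEstimate]
  exact ENNReal.ofReal_le_ofReal (by linarith [h.1 x])

/-- The Bayesian lower bound for the Gaussian prior with covariance `∑ i, yᵢ yᵢᵀ`. -/
theorem exists_sum_norm_sq_le_of_expSqError_le (hS : S.PosSemidef)
    {w : EuclideanSpace ℝ (Fin m) → EuclideanSpace ℝ (Fin ν)} (hw : Measurable w)
    {τ : ℝ} (hτ : 0 ≤ τ)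
    (h : ∀ x, expSqError A B σ w x ≤ ENNReal.ofReal (τ * (1 + quadForm S x)))
    {ι : Type*} [Fintype ι] (y : ι → EuclideanSpace ℝ (Fin n)) :
    ∃ H : Matrix (Fin m) (Fin ν) ℝ,
      ∑ i, ‖act (B - Hᵀ * A) (y i)‖ ^ 2 + σ ^ 2 * (Hᵀ * H).trace ≤
        τ * (1 + ∑ i, quadForm S (y i)) := by
  classical
  let e := EuclideanSpace.basisFun ι ℝ
  -- For `η` standard Gaussian, `C η` has covariance `∑ i, yᵢ yᵢᵀ`.
  let C : EuclideanSpace ℝ ι →ₗ[ℝ] EuclideanSpace ℝ (Fin n) := e.toBasis.constr ℝ y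
  have hC : ∀ i, C (e i) = y i := fun i => by
    have := e.toBasis.constr_basis ℝ y i
    rwa [e.coe_toBasis] at this
  have hmom : ∀ {k : ℕ} (M : Matrix (Fin k) (Fin n) ℝ),
      ∫⁻ η, ENNReal.ofReal (‖act M (C η)‖ ^ 2) ∂(stdGaussian (EuclideanSpace ℝ ι)) =
        ENNReal.ofReal (∑ i, ‖act M (y i)‖ ^ 2) := fun M => by
    have := lintegral_norm_add_linear_sq e 0 (toEuclideanLin M ∘ₗ C)
    simpa [hC, act_eq_toEuclideanLin] using this
  obtain ⟨K, hK⟩ :=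
    exists_linear_bayes_optimal_of_noisy_observation (toEuclideanLin A ∘ₗ C) σ
      (toEuclideanLin B ∘ₗ C)
  let H : Matrix (Fin m) (Fin ν) ℝ := (toEuclideanLin.symm K)ᵀ
  have hKH : ∀ ω, linearEstimate H ω = K ω := fun ω => by
    rw [linearEstimate, act_eq_toEuclideanLin, transpose_transpose, LinearEquiv.apply_symm_apply]
  refine ⟨H, ?_⟩
  have hH : ∫⁻ η, expSqError A B σ (linearEstimate H) (C η) ∂(stdGaussian (EuclideanSpace ℝ ι)) ≤
      ∫⁻ η, expSqError A B σ w (C η) ∂(stdGaussian (EuclideanSpace ℝ ι)) := by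
    simp_rw [expSqError, hKH]
    exact hK w hw
  replace hH := hH.trans (lintegral_mono fun η => h (C η))
  obtain ⟨R, hR⟩ := exists_quadForm_eq_norm_sq hS
  have htr : 0 ≤ (Hᵀ * H).trace := by
    rw [trace_transpose_mul_self]; positivity
  have hleft : ∫⁻ η, expSqError A B σ (linearEstimate H) (C η)
      ∂(stdGaussian (EuclideanSpace ℝ ι)) =
      ENNReal.ofReal (∑ i, ‖act (B - Hᵀ * A) (y i)‖ ^ 2 + σ ^ 2 * (Hᵀ * H).trace) := by
    simp_rw [expSqError_linearEstimate]
    rw [ENNReal.ofReal_add (by positivity) (by positivity), ← hmom]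
    simp_rw [ENNReal.ofReal_add (sq_nonneg ‖act _ _‖) (mul_nonneg (sq_nonneg σ) htr)]
    rw [lintegral_add_right _ measurable_const]
    simp
  have hright : ∫⁻ η, ENNReal.ofReal (τ * (1 + quadForm S (C η)))
      ∂(stdGaussian (EuclideanSpace ℝ ι)) =
      ENNReal.ofReal (τ * (1 + ∑ i, quadForm S (y i))) := by
    simp_rw [hR, ENNReal.ofReal_mul hτ]
    rw [lintegral_const_mul' _ _ ENNReal.ofReal_ne_top,
      ENNReal.ofReal_add zero_le_one (by positivity), ← hmom]
    simp_rw [ENNReal.ofReal_add zero_le_one (sq_nonneg ‖act _ _‖)]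
    rw [lintegral_add_left measurable_const]
    simp
  rw [hleft, hright] at hH
  refine (ENNReal.ofReal_le_ofReal_iff (mul_nonneg hτ ?_)).1 hH
  have := Finset.sum_nonneg fun i (_ : i ∈ Finset.univ) => quadForm_nonneg hS (y i)
  linarith

theorem trace_transpose_mul_self_nonneg {p q : ℕ} (H : Matrix (Fin p) (Fin q) ℝ) :
    0 ≤ (Hᵀ * H).trace := by
  rw [trace_transpose_mul_self]; positivity

theorem continuous_norm_act_sub_sq (x : EuclideanSpace ℝ (Fin n)) :
    Continuous fun H : Matrix (Fin m) (Fin ν) ℝ => ‖act (B - Hᵀ * A) x‖ ^ 2 := by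
  unfold act
  fun_prop

theorem isCompact_setOf_trace_le (hσ : 0 < σ) (c : ℝ) :
    IsCompact {H : Matrix (Fin m) (Fin ν) ℝ | σ ^ 2 * (Hᵀ * H).trace ≤ c} := by
  -- Each entry satisfies `t² ≤ c / σ²`, hence `|t| ≤ c / σ² + 1`; this avoids square roots.
  have hbox : IsCompact (Set.univ.pi fun _ : Fin m => Set.univ.pi fun _ : Fin ν =>
      Set.Icc (-(c / σ ^ 2 + 1)) (c / σ ^ 2 + 1)) :=
    isCompact_univ_pi fun _ => isCompact_univ_pi fun _ => isCompact_Icc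
  refine IsCompact.of_isClosed_subset hbox
    (isClosed_le (f := fun H : Matrix (Fin m) (Fin ν) ℝ => σ ^ 2 * (Hᵀ * H).trace)
      (by fun_prop) continuous_const) ?_
  intro H hH i _ j _
  have h1 : (Hᵀ * H).trace ≤ c / σ ^ 2 := by
    rw [le_div_iff₀ (by positivity)]
    have hH' : σ ^ 2 * (Hᵀ * H).trace ≤ c := hH
    linarith
  have h2 : H i j ^ 2 ≤ (Hᵀ * H).trace := by
    rw [trace_transpose_mul_self]
    exact (Finset.single_le_sum (f := fun i => H i j ^ 2) (fun _ _ => sq_nonneg _)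
      (Finset.mem_univ i)).trans (Finset.single_le_sum (f := fun j => ∑ i, H i j ^ 2)
        (fun _ _ => Finset.sum_nonneg fun _ _ => sq_nonneg _) (Finset.mem_univ j))
  constructor <;> nlinarith [sq_nonneg (H i j - 1), sq_nonneg (H i j + 1)]

theorem convexOn_norm_act_sub_sq (x : EuclideanSpace ℝ (Fin n)) :
    ConvexOn ℝ Set.univ fun H : Matrix (Fin m) (Fin ν) ℝ => ‖act (B - Hᵀ * A) x‖ ^ 2 := by
  have hsq := (convexOn_norm (E := EuclideanSpace ℝ (Fin ν)) convex_univ).pow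
    (fun _ _ => norm_nonneg _) 2
  refine ⟨convex_univ, fun H _ G _ a b ha hb hab => ?_⟩
  have h : act (B - (a • H + b • G)ᵀ * A) x = a • act (B - Hᵀ * A) x + b • act (B - Gᵀ * A) x := by
    have hM : B - (a • H + b • G)ᵀ * A = a • (B - Hᵀ * A) + b • (B - Gᵀ * A) := by
      conv_lhs => rw [← one_smul ℝ B, ← hab, add_smul]
      rw [transpose_add, transpose_smul, transpose_smul, Matrix.add_mul, Matrix.smul_mul, Matrix.smul_mul, smul_sub,
        smul_sub]
      abel
    rw [hM]
    simp [act, add_mulVec, smul_mulVec]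
  simp only [h]
  exact hsq.2 (Set.mem_univ _) (Set.mem_univ _) ha hb hab

theorem convexOn_trace_transpose_mul_self :
    ConvexOn ℝ Set.univ fun H : Matrix (Fin m) (Fin ν) ℝ => (Hᵀ * H).trace := by
  refine ⟨convex_univ, fun H _ G _ a b ha hb hab => ?_⟩
  simp only [trace_transpose_mul_self, smul_eq_mul, Finset.mul_sum, ← Finset.sum_add_distrib]
  gcongr with j _ i _
  have := (even_two.convexOn_pow (𝕜 := ℝ)).2 (Set.mem_univ (H i j)) (Set.mem_univ (G i j)) ha hb hab
  simpa using this

/-- The feasible set is closed, and below a known feasible value `τ₀` the trace constraint bounds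
`H`, so the minimum is over a compact set. -/
theorem exists_isOptimalSolution (hS : S.PosSemidef) (hσ : 0 < σ)
    (hfeas : ∃ (τ : ℝ) (H : Matrix (Fin m) (Fin ν) ℝ), IsFeasible A B S σ τ H) :
    ∃ (τ : ℝ) (H : Matrix (Fin m) (Fin ν) ℝ), IsOptimalSolution A B S σ τ H := by
  obtain ⟨τ₀, H₀, h₀⟩ := hfeas
  have hnonneg : ∀ {τ : ℝ} {H : Matrix (Fin m) (Fin ν) ℝ}, IsFeasible A B S σ τ H → 0 ≤ τ :=
    fun h => (mul_nonneg (sq_nonneg σ) (trace_transpose_mul_self_nonneg _)).trans h.2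
  have hclosed : IsClosed {p : ℝ × Matrix (Fin m) (Fin ν) ℝ | IsFeasible A B S σ p.1 p.2} := by
    simp only [isFeasible_iff hS, Set.ofPred_and, Set.ofPred_forall]
    refine (isClosed_iInter fun x => isClosed_le ?_ (by fun_prop)).inter
      (isClosed_le (by fun_prop) continuous_fst)
    exact (continuous_norm_act_sub_sq x).comp continuous_snd
  have hcompact := ((isCompact_Icc (a := 0) (b := τ₀)).prod
    (isCompact_setOf_trace_le (m := m) (ν := ν) hσ τ₀)).inter_right hclosed
  obtain ⟨⟨τ, H⟩, ⟨⟨hτ, -⟩, hF⟩, hmin⟩ := hcompact.exists_isMinOn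
    ⟨(τ₀, H₀), ⟨⟨hnonneg h₀, le_rfl⟩, h₀.2⟩, h₀⟩ continuous_fst.continuousOn
  refine ⟨τ, H, hF, fun τ' H' h' => ?_⟩
  rcases le_or_gt τ' τ₀ with hle | hlt
  · exact hmin (a := (τ', H')) ⟨⟨⟨hnonneg h', hle⟩, h'.2.trans hle⟩, h'⟩
  · exact hτ.2.trans hlt.le

theorem exists_pos_of_not_isFeasible (hS : S.PosSemidef) {τ : ℝ} (hτ : 0 ≤ τ)
    {H : Matrix (Fin m) (Fin ν) ℝ} (h : ¬ IsFeasible A B S σ τ H) :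
    ∃ x, 0 < ‖act (B - Hᵀ * A) x‖ ^ 2 + σ ^ 2 * (Hᵀ * H).trace - τ * (1 + quadForm S x) := by
  rw [isFeasible_iff hS, not_and_or] at h
  push Not at h
  rcases h with ⟨x, hx⟩ | h
  · set d := ‖act (B - Hᵀ * A) x‖ ^ 2 - τ * quadForm S x with hd
    have hd0 : 0 < d := sub_pos.2 hx
    -- The excess `d` is homogeneous of degree two; this scaling raises it to `τ + 1`, which beats
    -- the constant term `τ`.
    refine ⟨√((τ + 1) / d) • x, ?_⟩
    rw [act_smul, norm_smul, mul_pow, quadForm_smul, Real.norm_eq_abs, sq_abs,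
      Real.sq_sqrt (by positivity)]
    have h1 : (τ + 1) / d * d = τ + 1 := div_mul_cancel₀ _ hd0.ne'
    have h2 := mul_nonneg (sq_nonneg σ) (trace_transpose_mul_self_nonneg H)
    rw [hd] at h1
    nlinarith
  · refine ⟨0, ?_⟩
    have h0 : quadForm S 0 = 0 := by simp [quadForm]
    have := sq_nonneg ‖act (B - Hᵀ * A) 0‖
    rw [h0]
    linarith

/-- No Borel estimate has a smaller squared risk bound than the optimal value of the program. -/
theorem le_of_expSqError_le (hS : S.PosSemidef) (hσ : 0 < σ) {Opt : ℝ}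
    (hopt : ∀ (τ' : ℝ) (H' : Matrix (Fin m) (Fin ν) ℝ), IsFeasible A B S σ τ' H' → Opt ≤ τ')
    {w : EuclideanSpace ℝ (Fin m) → EuclideanSpace ℝ (Fin ν)} (hw : Measurable w)
    {τ : ℝ} (hτ : 0 ≤ τ)
    (h : ∀ x, expSqError A B σ w x ≤ ENNReal.ofReal (τ * (1 + quadForm S x))) :
    Opt ≤ τ := by
  classical
  by_contra! hlt
  obtain ⟨τ', hτ', hOpt⟩ := exists_between hlt
  have hτ'0 : 0 ≤ τ' := hτ.trans hτ'.le
  let g : EuclideanSpace ℝ (Fin n) → Matrix (Fin m) (Fin ν) ℝ → ℝ := fun x H =>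
    ‖act (B - Hᵀ * A) x‖ ^ 2 + σ ^ 2 * (Hᵀ * H).trace - τ' * (1 + quadForm S x)
  have hpos : ∀ H, ∃ x, 0 < g x H := fun H =>
    exists_pos_of_not_isFeasible hS hτ'0 fun hH => (hopt τ' H hH).not_gt hOpt
  have hcont : ∀ x, Continuous (g x) := fun x =>
    ((continuous_norm_act_sub_sq x).add (by fun_prop)).sub continuous_const
  have hconv : ∀ x, ConvexOn ℝ Set.univ (g x) := fun x =>
    ((convexOn_norm_act_sub_sq x).add
      (convexOn_trace_transpose_mul_self.smul (sq_nonneg σ))).sub (concaveOn_const _ convex_univ)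
  obtain ⟨t, ht⟩ := (isCompact_setOf_trace_le (m := m) (ν := ν) hσ τ').elim_finite_subcover
    (fun x => {H | 0 < g x H}) (fun x => isOpen_lt continuous_const (hcont x))
    (fun H _ => Set.mem_iUnion.2 (hpos H))
  -- The added point `0` covers every `H` outside the compact set, where the trace term alone
  -- exceeds `τ'`.
  have hfin : ∀ H, ∃ x : (insert 0 t : Finset (EuclideanSpace ℝ (Fin n))), 0 ≤ g x H := by
    intro H
    by_cases hH : σ ^ 2 * (Hᵀ * H).trace ≤ τ'
    · obtain ⟨x, hx, hxH⟩ := Set.mem_iUnion₂.1 (ht hH)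
      exact ⟨⟨x, Finset.mem_insert_of_mem hx⟩, le_of_lt hxH⟩
    · refine ⟨⟨0, Finset.mem_insert_self _ _⟩, ?_⟩
      have h0 : quadForm S 0 = 0 := by simp [quadForm]
      have := sq_nonneg ‖act (B - Hᵀ * A) 0‖
      simp only [g, h0]
      linarith
  obtain ⟨c, hc, hc1, hsum⟩ := exists_weights_of_forall_exists_nonneg (fun i : (insert 0 t :
    Finset (EuclideanSpace ℝ (Fin n))) => hconv i) hfin
  -- Scaling by `√(c i)` puts the weights into the covariance. For this `H` the two bounds give `τ'
  -- (1 + q) ≤ τ (1 + q)`, where `q = ∑ i, c i * quadForm S i ≥ 0`, contradicting `τ < τ'`.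
  obtain ⟨H, hH⟩ := exists_sum_norm_sq_le_of_expSqError_le hS hw hτ h
    (fun i : (insert 0 t : Finset (EuclideanSpace ℝ (Fin n))) => √(c i) • i.1)
  simp only [act_smul, norm_smul, mul_pow, quadForm_smul, Real.norm_eq_abs, sq_abs,
    Real.sq_sqrt (hc _)] at hH
  have hgH := hsum H
  simp only [g, mul_sub, mul_add, Finset.sum_sub_distrib, Finset.sum_add_distrib,
    ← Finset.sum_mul, hc1, mul_one, one_mul] at hgH
  have hq : ∑ i, c i * (τ' * quadForm S i.1) = τ' * ∑ i, c i * quadForm S i.1 := by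
    rw [Finset.mul_sum]
    exact Finset.sum_congr rfl fun _ _ => by ring
  rw [hq] at hgH
  have hq0 : 0 ≤ ∑ i, c i * quadForm S i.1 :=
    Finset.sum_nonneg fun i _ => mul_nonneg (hc i) (quadForm_nonneg hS _)
  nlinarith

end SRisk

theorem proposition2 (n m ν : ℕ) (A : Matrix (Fin m) (Fin n) ℝ)
    (B : Matrix (Fin ν) (Fin n) ℝ) (S : Matrix (Fin n) (Fin n) ℝ) (hS : S.PosSemidef)
    (σ : ℝ) (hσ : 0 < σ)
    (hfeas : ∃ (τ : ℝ) (H : Matrix (Fin m) (Fin ν) ℝ), SRisk.IsFeasible A B S σ τ H) :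
    (∃ (Opt : ℝ) (H : Matrix (Fin m) (Fin ν) ℝ), SRisk.IsOptimalSolution A B S σ Opt H) ∧
    ∀ (Opt : ℝ) (H : Matrix (Fin m) (Fin ν) ℝ), SRisk.IsOptimalSolution A B S σ Opt H →
      SRisk.riskS A B S σ Set.univ (SRisk.linearEstimate H) = ENNReal.ofReal (Real.sqrt Opt) ∧
      SRisk.minimaxRiskS A B S σ Set.univ = ENNReal.ofReal (Real.sqrt Opt) := by
  refine ⟨SRisk.exists_isOptimalSolution hS hσ hfeas, fun Opt H hH => ?_⟩
  have hOpt : 0 ≤ Opt :=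
    (mul_nonneg (sq_nonneg σ) (SRisk.trace_transpose_mul_self_nonneg H)).trans hH.1.2
  have hupper := SRisk.riskS_linearEstimate_le hS hOpt hH.1
  have hlower : ∀ w : EuclideanSpace ℝ (Fin m) → EuclideanSpace ℝ (Fin ν), Measurable w →
      ENNReal.ofReal (Real.sqrt Opt) ≤ SRisk.riskS A B S σ Set.univ w := by
    intro w hw
    refine le_sInf ?_
    rintro _ ⟨τ, hτ, h, rfl⟩
    exact ENNReal.ofReal_le_ofReal (Real.sqrt_le_sqrt
      (SRisk.le_of_expSqError_le hS hσ hH.2 hw hτ fun x => h x (Set.mem_univ x)))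
  have hmeas : Measurable (SRisk.linearEstimate H) := (SRisk.continuous_act _).measurable
  exact ⟨le_antisymm hupper (hlower _ hmeas),
    le_antisymm ((iInf₂_le _ hmeas).trans hupper) (le_iInf₂ hlower)⟩
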